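/- Let $q$ be a prime power and $b\in\mathbb F_{q^4}$, and let $U(b)=\{(x,\,bx^q+x^{q^3}) : x\in\mathbb F_{q^4}\}$, an $\mathbb F_q$-subspace of $\mathbb F_{q^4}^2$. For an $\mathbb F_q$-subspace $U$ of $\mathbb F_{q^4}^2$, let $L_U=\{\langle v\rangle_{\mathbb F_{q^4}} : v\in U\setminus\{0\}\}$ be the associated $\mathbb F_q$-linear set of points of $\mathrm{PG}(1,q^4)$; the weight of a point $P=\langle v\rangle_{\mathbb F_{q^4}}$ is $\dim_{\mathbb F_q}(U\cap P)$, and $L_U$ is called scattered if $|L_U|=(q^r-1)/(q-1)$, where $r=\dim_{\mathbb F_q}U$. Let $\mathrm N_{q^4/q}$ and $\mathrm N_{q^4/q^2}$ denote the norms from $\mathbb F_{q^4}$ to $\mathbb F_q$ and to $\mathbb F_{q^2}$. Then the following hold. 1. If $\mathrm N_{q^4/q}(b)\neq 1$, then $L_{U(b)}$ is scattered. 2. If $\mathrm N_{q^4/q^2}(b)=1$, then $\langle(1,0)\rangle_{\mathbb F_{q^4}}$ is a point of $L_{U(b)}$ of weight two, and all other points of $L_{U(b)}$ have weight one. 3.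 If $\mathrm N_{q^4/q^2}(b)\neq 1$ and $\mathrm N_{q^4/q}(b)=1$, then $L_{U(b)}$ has exactly $q+1$ points of weight two, and all its other points have weight one. -/

import Mathlib

open scoped LinearAlgebra.Projectivization

namespace LinearSets

section General

variable (F : Type*) {W : Type*} [Field F] [AddCommGroup W] [Module F W]

/-- The `F`-linear set `L_U = {⟨v⟩_K : v ∈ U, v ≠ 0}` of points of the projective space of the
`K`-vector space `W`, where `U` is an `F`-subspace of `W`. -/
def linearSet (K : Type*) [Field K] [Module K W] (U : Submodule F W) : Set (ℙ K W) :=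
  {P | ∃ (v : W) (hv : v ≠ 0), v ∈ U ∧ P = Projectivization.mk K v hv}

/-- The weight `dim_F (U ∩ P)` of a point `P` with respect to `U`. -/
noncomputable def weight {K : Type*} [Field K] [Algebra F K] [Module K W] [IsScalarTower F K W]
    (U : Submodule F W) (P : ℙ K W) : ℕ :=
  Module.finrank F ↥(U ⊓ P.submodule.restrictScalars F)

/-- `L_U` is scattered if it has `(q ^ r - 1) / (q - 1)` points, where `q = |F|` and `r = dim_F U`
(the division is exact). -/
def IsScattered (K : Type*) [Field K] [Module K W] (U : Submodule F W) : Prop :=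
  (linearSet F K U).ncard =
    (Nat.card F ^ Module.finrank F ↥U - 1) / (Nat.card F - 1)

end General

section FiniteField

variable (F : Type*) {K : Type*} [Field F] [Finite F] [Field K] [Algebra F K]

/-- Raising to the power `|F|` is additive on every extension field of `F`. -/
theorem add_pow_card (x y : K) :
    (x + y) ^ Nat.card F = x ^ Nat.card F + y ^ Nat.card F := by
  have := Fintype.ofFinite F
  have h := map_add (FiniteField.frobeniusAlgHom F K) x y
  simpa [Nat.card_eq_fintype_card] using h

/-- Raising to the power `|F| ^ n` is additive on every extension field of `F`. -/
theorem add_pow_card_pow (n : ℕ) (x y : K) :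
    (x + y) ^ Nat.card F ^ n = x ^ Nat.card F ^ n + y ^ Nat.card F ^ n := by
  induction n with
  | zero => simp
  | succ n ih => rw [pow_succ, pow_mul, ih, add_pow_card, ← pow_mul, ← pow_mul]

/-- Raising to the power `|F| ^ n` is `F`-homogeneous. -/
theorem smul_pow_card_pow (n : ℕ) (c : F) (x : K) :
    (c • x) ^ Nat.card F ^ n = c • x ^ Nat.card F ^ n := by
  have := Fintype.ofFinite F
  rw [smul_pow, Nat.card_eq_fintype_card, FiniteField.pow_card_pow]

/-- The `F`-subspace `U(b) = {(x, b x^q + x^(q^3)) : x ∈ K}` of `K × K`, where `q = |F|`. -/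
def U (b : K) : Submodule F (K × K) where
  carrier := {v | ∃ x : K, v = (x, b * x ^ Nat.card F + x ^ Nat.card F ^ 3)}
  add_mem' := by
    rintro _ _ ⟨x, rfl⟩ ⟨y, rfl⟩
    refine ⟨x + y, ?_⟩
    rw [add_pow_card, add_pow_card_pow, Prod.mk_add_mk]
    congr 1
    ring
  zero_mem' := by
    refine ⟨0, ?_⟩
    rw [zero_pow Nat.card_pos.ne', zero_pow (pow_pos Nat.card_pos 3).ne', mul_zero, add_zero]
    rfl
  smul_mem' := by
    rintro c _ ⟨x, rfl⟩
    refine ⟨c • x, ?_⟩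
    have h := smul_pow_card_pow F 1 c x
    rw [pow_one] at h
    rw [h, smul_pow_card_pow, Prod.smul_mk, smul_add, mul_smul_comm]

end FiniteField

/-- The point `⟨(1, 0)⟩_K` of the projective line over `K`. -/
def pointOneZero (K : Type*) [Field K] : ℙ K (K × K) :=
  Projectivization.mk K ((1 : K), (0 : K)) (by simp)

end LinearSets

/-! Let `σ` be `x ↦ x^q`, so `σ⁴ = 1` with fixed field `F`. Every point of `L_{U(b)}` is `⟨(1,m)⟩`,
and its weight is the dimension of the solution space of `b σ(x) + σ³(x) = m x`
(`weight_pointOfSlope`). Applying `σ` turns this into the second-order equation `σ(b) σ²(x) = σ(m)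
σ(x) - x`, so a Wronskian argument bounds every weight by two.

For weight two, the Wronskian `w` of two independent solutions satisfies `σ(b) σ(w) = w`; going once
around the orbit forces norm one. This gives the scattered case. Eliminating higher terms also
yields two equations in `m` (`eq_of_finrank_slopeSpace_eq_two`), which with norm one are sufficient
(`finrank_slopeSpace_eq_two`).

If `b σ²(b) = 1`, these say `m = 0`. Otherwise they say `m^(q+1) = c` with `c = b (1 - σ(b) σ³(b))`
(`slope_conditions_iff`). As `c σ²(c)` is fixed by `σ`, `c` is a `(q+1)`-st power, and there are `q
+ 1` roots. -/

namespace LinearSets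

/-! ### Equations in a field endomorphism `σ` -/

section Semilinear

variable {F K V : Type*} [Field F] [Field K] [Algebra F K] [AddCommGroup V] [Module F V]
  {σ : K →ₐ[F] K}

/-- If the fixed field of `σ` is `F`, then vectors whose ratios are all fixed by `σ` span a space of
dimension at most one. -/
theorem finrank_le_one_of_mul_map_eq (hfix : ∀ x, σ x = x → ∃ c : F, algebraMap F K c = x)
    (f : V →ₗ[F] K) (hf : Function.Injective f)
    (h : ∀ x y, f x * σ (f y) = σ (f x) * f y) : Module.finrank F V ≤ 1 := by
  by_cases h0 : ∀ v : V, v = 0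
  · exact finrank_le_one 0 fun w => ⟨0, by rw [h0 w, smul_zero]⟩
  · push Not at h0
    obtain ⟨v, hv⟩ := h0
    have hv' : f v ≠ 0 := fun e => hv (hf (by rw [e, map_zero]))
    have hσ : σ (f v) ≠ 0 := by rwa [Ne, map_eq_zero]
    refine finrank_le_one v fun w => ?_
    obtain ⟨c, hc⟩ := hfix (f w / f v) (by
      rw [map_div₀, div_eq_div_iff hσ hv', mul_comm, h, mul_comm])
    refine ⟨c, hf ?_⟩
    rw [map_smul, Algebra.smul_def, hc, div_mul_cancel₀ _ hv']

/-- The Wronskian `y ↦ x σ(y) - σ(x) y`. -/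
def wronskian (σ : K →ₐ[F] K) (x : K) : K →ₗ[F] K :=
  LinearMap.mulLeft F x ∘ₗ σ.toLinearMap - LinearMap.mulLeft F (σ x)

/-- A second-order homogeneous equation in `σ` has a solution space of dimension at most two. -/
theorem finrank_le_two_of_map_map_eq [FiniteDimensional F K]
    (hfix : ∀ x, σ x = x → ∃ c : F, algebraMap F K c = x)
    {S : Submodule F K} {a c m : K} (hc : c ≠ 0)
    (h : ∀ x ∈ S, c * σ (σ x) = m * σ x + a * x) : Module.finrank F S ≤ 2 := by
  by_cases h0 : S = ⊥
  · subst h0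
    rw [finrank_bot]
    exact zero_le_two
  obtain ⟨x, hx, hx0⟩ := S.exists_mem_ne_zero_of_ne_bot h0
  let W : S →ₗ[F] K := wronskian σ x ∘ₗ S.subtype
  have hker : Module.finrank F (LinearMap.ker W) ≤ 1 := by
    refine finrank_le_one_of_mul_map_eq (V := LinearMap.ker W) hfix
      (S.subtype ∘ₗ (LinearMap.ker W).subtype) (fun _ _ e => Subtype.ext (Subtype.ext e)) ?_
    rintro ⟨⟨y, -⟩, hy⟩ ⟨⟨z, -⟩, hz⟩
    have hy' : x * σ y - σ x * y = 0 := hy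
    have hz' : x * σ z - σ x * z = 0 := hz
    change y * σ z = σ y * z
    apply mul_left_cancel₀ hx0
    linear_combination y * hz' - z * hy'
  have hrange : Module.finrank F (LinearMap.range W) ≤ 1 := by
    refine finrank_le_one_of_mul_map_eq hfix (LinearMap.range W).subtype
      (LinearMap.range W).injective_subtype ?_
    -- As for differential equations (Abel's identity), Wronskians of solutions satisfy a
    -- first-order equation.
    have key : ∀ w : LinearMap.range W, c * σ w = -a * w := by
      rintro ⟨_, ⟨y, hy⟩, rfl⟩
      change c * σ (x * σ y - σ x * y) = -a * (x * σ y - σ x * y)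
      rw [map_sub, map_mul, map_mul]
      linear_combination σ x * h y hy - σ y * h x hx
    intro v w
    change (v : K) * σ w = σ v * w
    apply mul_left_cancel₀ hc
    linear_combination (v : K) * key w - (w : K) * key v
  have := W.finrank_range_add_finrank_ker
  omega

/-- The space of solutions of `b σ(x) + σ³(x) = m x`. -/
def slopeSpace (σ : K →ₐ[F] K) (b m : K) : Submodule F K where
  carrier := {x | b * σ x + σ (σ (σ x)) = m * x}
  add_mem' := by
    intro x y hx hy
    simp only [Set.mem_ofPred_eq, map_add] at *
    linear_combination hx + hy
  zero_mem' := by simp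
  smul_mem' := by
    intro c x hx
    simp only [Set.mem_ofPred_eq, map_smul, mul_smul_comm, ← smul_add] at *
    rw [hx]

theorem mem_slopeSpace {b m x : K} :
    x ∈ slopeSpace σ b m ↔ b * σ x + σ (σ (σ x)) = m * x := Iff.rfl

theorem map_eq_of_mem_slopeSpace (hσ : ∀ x, σ (σ (σ (σ x))) = x) {b m x : K}
    (hx : x ∈ slopeSpace σ b m) : σ b * σ (σ x) = σ m * σ x + -1 * x := by
  have := congrArg σ hx
  simp only [map_add, map_mul, hσ] at this
  linear_combination this

theorem finrank_slopeSpace_le_two [FiniteDimensional F K]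
    (hfix : ∀ x, σ x = x → ∃ c : F, algebraMap F K c = x) (hσ : ∀ x, σ (σ (σ (σ x))) = x)
    (b m : K) : Module.finrank F (slopeSpace σ b m) ≤ 2 := by
  -- For `b = 0` the leading coefficient vanishes and the equation is already of first order.
  by_cases hb : b = 0
  · refine (finrank_le_one_of_mul_map_eq hfix (slopeSpace σ b m).subtype
      (slopeSpace σ b m).injective_subtype ?_).trans one_le_two
    rintro ⟨x, hx⟩ ⟨y, hy⟩
    have h1 := map_eq_of_mem_slopeSpace hσ hx
    have h2 := map_eq_of_mem_slopeSpace hσ hy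
    rw [hb, map_zero] at h1 h2
    change x * σ y = σ x * y
    linear_combination σ y * h1 - σ x * h2
  · exact finrank_le_two_of_map_map_eq hfix (by rwa [Ne, map_eq_zero])
      fun x hx => map_eq_of_mem_slopeSpace hσ hx

theorem eq_of_finrank_slopeSpace_eq_two
    (hfix : ∀ x, σ x = x → ∃ c : F, algebraMap F K c = x) (hσ : ∀ x, σ (σ (σ (σ x))) = x)
    {b m : K} (h : Module.finrank F (slopeSpace σ b m) = 2) :
    b * σ b * σ (σ b) * σ (σ (σ b)) = 1 ∧ σ m = -(b * σ b * σ (σ (σ m))) ∧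
      σ b * (m * σ (σ (σ m)) - σ (σ (σ b))) = -1 := by
  obtain ⟨x, hx, y, hy, hw⟩ : ∃ x ∈ slopeSpace σ b m, ∃ y ∈ slopeSpace σ b m,
      x * σ y - σ x * y ≠ 0 := by
    by_contra! hcon
    have := finrank_le_one_of_mul_map_eq hfix (slopeSpace σ b m).subtype
      (slopeSpace σ b m).injective_subtype fun x y => sub_eq_zero.1 (hcon x x.2 y y.2)
    omega
  have h1 : σ b * σ (x * σ y - σ x * y) = x * σ y - σ x * y := by
    rw [map_sub, map_mul, map_mul]
    linear_combination σ x * map_eq_of_mem_slopeSpace hσ hy -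
      σ y * map_eq_of_mem_slopeSpace hσ hx
  -- Eliminating `σ²(z)` and `σ³(z)` leaves a first-order relation; holding for two independent
  -- solutions, it must have both coefficients zero.
  have hrel : ∀ z ∈ slopeSpace σ b m,
      (σ b * (m * σ (σ (σ m)) - σ (σ (σ b))) + 1) * z
        = (σ m + b * σ b * σ (σ (σ m))) * σ z := by
    intro z hz
    have e1 := map_eq_of_mem_slopeSpace hσ hz
    have e3 : σ (σ (σ b)) * z = σ (σ (σ m)) * σ (σ (σ z)) - σ (σ z) := by
      have := congrArg (fun t => σ (σ t)) e1
      simpa [hσ, sub_eq_add_neg] using this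
    have e0 := mem_slopeSpace.1 hz
    linear_combination e1 - σ b * e3 - σ b * σ (σ (σ m)) * e0
  have hrx := hrel x hx
  have hry := hrel y hy
  refine ⟨?_, ?_, ?_⟩
  · set w := x * σ y - σ x * y with hwdef
    have h2 := congrArg σ h1
    have h3 := congrArg (fun t => σ (σ t)) h1
    have h4 := congrArg (fun t => σ (σ (σ t))) h1
    simp only [map_mul, hσ] at h2 h3 h4
    apply mul_right_cancel₀ hw
    -- Chaining the four conjugates of `σ(b) σ(w) = w` returns to `w`, multiplied by the norm of
    -- `b`.
    linear_combination h1 + σ b * h2 + σ b * σ (σ b) * h3 + σ b * σ (σ b) * σ (σ (σ b)) * h4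
  · have : (σ m + b * σ b * σ (σ (σ m))) * (x * σ y - σ x * y) = 0 := by
      linear_combination y * hrx - x * hry
    linear_combination (mul_eq_zero.1 this).resolve_right hw
  · have : (σ b * (m * σ (σ (σ m)) - σ (σ (σ b))) + 1) * (x * σ y - σ x * y) = 0 := by
      linear_combination σ y * hrx - σ x * hry
    linear_combination (mul_eq_zero.1 this).resolve_right hw

theorem finrank_slopeSpace_eq_two [FiniteDimensional F K] (hK : Module.finrank F K = 4)
    (hfix : ∀ x, σ x = x → ∃ c : F, algebraMap F K c = x) (hσ : ∀ x, σ (σ (σ (σ x))) = x)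
    {b m : K} (hN : b * σ b * σ (σ b) * σ (σ (σ b)) = 1)
    (hA : σ m = -(b * σ b * σ (σ (σ m))))
    (hB : σ b * (m * σ (σ (σ m)) - σ (σ (σ b))) = -1) :
    Module.finrank F (slopeSpace σ b m) = 2 := by
  have hA' : σ (σ m) = -(σ b * σ (σ b) * m) := by
    simpa [hσ] using congrArg σ hA
  have hB2 : σ (σ (σ b)) * (σ (σ m) * σ m - σ b) = -1 := by
    simpa [hσ] using congrArg (fun t => σ (σ t)) hB
  have hB3 : b * (σ (σ (σ m)) * σ (σ m) - σ (σ b)) = -1 := by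
    simpa [hσ] using congrArg (fun t => σ (σ (σ t))) hB
  have hb : σ (σ (σ b)) ≠ 0 := by
    intro h
    simp [h] at hN
  have hc : σ m * σ (σ m) - σ b ≠ 0 := by
    intro h
    rw [mul_comm (σ (σ m)), h] at hB2
    simp at hB2
  -- Chosen so that `(bσ + σ³ - m) ∘ g = 0`. Being of second order, `g` has kernel of dimension at
  -- most two, so its range supplies at least `4 - 2` dimensions of solutions.
  let g : K →ₗ[F] K := LinearMap.id + LinearMap.mulLeft F (σ m) ∘ₗ σ.toLinearMap +
    LinearMap.mulLeft F (σ m * σ (σ m) - σ b) ∘ₗ σ.toLinearMap ∘ₗ σ.toLinearMap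
  have hg : ∀ z, g z = z + σ m * σ z + (σ m * σ (σ m) - σ b) * σ (σ z) := fun z => rfl
  have hker : Module.finrank F (LinearMap.ker g) ≤ 2 := by
    refine finrank_le_two_of_map_map_eq (m := -σ m) (a := -1) hfix hc fun z hz => ?_
    rw [LinearMap.mem_ker, hg] at hz
    linear_combination hz
  have hrange : LinearMap.range g ≤ slopeSpace σ b m := by
    rintro _ ⟨z, rfl⟩
    rw [mem_slopeSpace, hg]
    simp only [map_add, map_mul, map_sub, hσ]
    have e : b * σ (σ m) = m * (σ m * σ (σ m) - σ b) := by
      apply mul_left_cancel₀ hb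
      linear_combination b * σ (σ (σ b)) * hA' - m * hN - m * hB2
    linear_combination σ (σ z) * e + σ (σ (σ z)) * hB3
  have h1 := Submodule.finrank_mono hrange
  have h2 := g.finrank_range_add_finrank_ker
  have h3 := finrank_slopeSpace_le_two hfix hσ b m
  omega

theorem slope_conditions_iff (hσ : ∀ x, σ (σ (σ (σ x))) = x) {b m : K}
    (hN : b * σ b * σ (σ b) * σ (σ (σ b)) = 1) (hb : b * σ (σ b) ≠ 1) :
    (σ m = -(b * σ b * σ (σ (σ m))) ∧ σ b * (m * σ (σ (σ m)) - σ (σ (σ b))) = -1) ↔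
      m * σ m = b * (1 - σ b * σ (σ (σ b))) := by
  constructor
  · rintro ⟨-, hB⟩
    have hB1 : σ (σ b) * (σ m * m - b) = -1 := by
      simpa [hσ] using congrArg σ hB
    linear_combination b * σ b * σ (σ (σ b)) * hB1 - (m * σ m - b) * hN
  · intro h
    have h1 : σ m * σ (σ m) = σ b * (1 - σ (σ b) * b) := by
      simpa [hσ] using congrArg σ h
    have h2 : σ (σ m) * σ (σ (σ m)) = σ (σ b) * (1 - σ (σ (σ b)) * σ b) := by
      simpa [hσ] using congrArg (fun t => σ (σ t)) h
    have h3 : σ (σ (σ m)) * m = σ (σ (σ b)) * (1 - b * σ (σ b)) := by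
      simpa [hσ] using congrArg (fun t => σ (σ (σ t))) h
    have hm : σ (σ m) ≠ 0 := by
      intro h0
      rw [h0, mul_zero] at h1
      rcases mul_eq_zero.1 h1.symm with h' | h'
      · simp [h'] at hN
      · exact hb (by linear_combination -h')
    refine ⟨mul_right_cancel₀ hm ?_, ?_⟩
    · linear_combination h1 + b * σ b * h2 - σ b * hN
    · linear_combination σ b * h3 - hN

/-- With `u = b σ²(b)` and `v = σ(u)`, `hN` says `uv = 1`. Hence `C σ²(C) = u (1 - v)² = u - 2 + v`,
and `σ` swaps `u` and `v`. -/
theorem map_norm_slope (hσ : ∀ x, σ (σ (σ (σ x))) = x) {b C : K}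
    (hN : b * σ b * σ (σ b) * σ (σ (σ b)) = 1) (hC : C = b * (1 - σ b * σ (σ (σ b)))) :
    σ (C * σ (σ C)) = C * σ (σ C) := by
  subst hC
  simp only [map_mul, map_sub, map_one, hσ]
  linear_combination (b * σ (σ b) - σ b * σ (σ (σ b))) * hN

end Semilinear

/-! ### Counting roots in finite cyclic groups -/

section Cyclic

/-- The `n`-th powers lie in the `k`-torsion and both subgroups have order `k`, so they agree; the
roots of `c` then form a coset of the `n`-torsion. -/
theorem ncard_pow_eq_of_pow_eq_one {G : Type*} [CommGroup G] [IsCyclic G] [Finite G] {n k : ℕ}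
    (hG : Nat.card G = n * k) {c : G} (hc : c ^ k = 1) : {x : G | x ^ n = c}.ncard = n := by
  have hpos : 0 < n * k := hG ▸ Nat.card_pos
  have hn : 0 < n := Nat.pos_of_mul_pos_right hpos
  have hle : (powMonoidHom n : G →* G).range ≤ (powMonoidHom k : G →* G).ker := by
    rintro _ ⟨x, rfl⟩
    rw [MonoidHom.mem_ker, powMonoidHom_apply, powMonoidHom_apply, ← pow_mul, ← hG,
      pow_card_eq_one']
  have heq : (powMonoidHom n : G →* G).range = (powMonoidHom k : G →* G).ker := by
    refine Subgroup.eq_of_le_of_card_ge hle ?_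
    rw [IsCyclic.card_powMonoidHom_ker, IsCyclic.card_powMonoidHom_range, hG,
      Nat.gcd_mul_left_left, Nat.gcd_mul_right_left, Nat.mul_div_cancel_left _ hn]
  obtain ⟨x, hx⟩ : c ∈ (powMonoidHom n : G →* G).range := heq ▸ hc
  rw [powMonoidHom_apply] at hx
  have himg : {y : G | y ^ n = c} = (fun z => x * z) '' ((powMonoidHom n : G →* G).ker : Set G) := by
    ext y
    simp only [Set.mem_ofPred_eq, Set.image_mul_left, Set.mem_preimage, SetLike.mem_coe,
      MonoidHom.mem_ker, powMonoidHom_apply, mul_pow, inv_pow, hx, inv_mul_eq_one]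
    exact eq_comm
  rw [himg, Set.ncard_image_of_injective _ (mul_right_injective x), ← Nat.card_coe_set_eq]
  exact (IsCyclic.card_powMonoidHom_ker G n).trans (by rw [hG, Nat.gcd_mul_right_left])

theorem ncard_pow_eq_of_pow_eq_one_of_field {K : Type*} [Field K] [Finite K] {n k : ℕ}
    (hK : Nat.card K = n * k + 1) {c : K} (hc0 : c ≠ 0) (hc : c ^ k = 1) :
    {x : K | x ^ n = c}.ncard = n := by
  have hcard : Nat.card Kˣ = n * k := by
    rw [Nat.card_units, hK, Nat.add_sub_cancel]
  have hn : n ≠ 0 := by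
    rintro rfl
    exact Nat.card_pos.ne' (hcard.trans (zero_mul k))
  have hu : (Units.mk0 c hc0) ^ k = 1 := Units.ext (by simpa using hc)
  refine Eq.trans ?_ (ncard_pow_eq_of_pow_eq_one hcard hu)
  rw [← Set.ncard_image_of_injective _ (Units.val_injective (α := K))]
  congr 1
  ext x
  constructor
  · intro hx
    have hx0 : x ≠ 0 := by
      rintro rfl
      exact hc0 ((zero_pow hn).symm.trans hx).symm
    exact ⟨Units.mk0 x hx0, Units.ext (by simpa using hx), rfl⟩
  · rintro ⟨u, hu', rfl⟩
    simpa using congrArg Units.val hu'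

end Cyclic

end LinearSets

namespace LinearSets

/-! ### Weights and scatteredness -/

section Weight

variable {F K W : Type*} [Field F] [Field K] [Algebra F K] [AddCommGroup W] [Module F W]
  [Module K W] [IsScalarTower F K W]

theorem mem_inf_submodule_mk {U : Submodule F W} {v w : W} (hv : v ≠ 0) :
    w ∈ U ⊓ (Projectivization.mk K v hv).submodule.restrictScalars F ↔
      w ∈ U ∧ ∃ a : K, a • v = w := by
  rw [Submodule.mem_inf, Submodule.restrictScalars_mem, Projectivization.submodule_mk,
    Submodule.mem_span_singleton]

/-- A linear set all of whose points have weight one is scattered. -/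
theorem isScattered_of_forall_weight_eq_one [Finite F] [FiniteDimensional F W] {U : Submodule F W}
    (h : ∀ P ∈ linearSet F K U, weight F U P = 1) : IsScattered F K U := by
  let f : U →ₛₗ[algebraMap F K] W :=
    { toFun := fun v => v
      map_add' := fun _ _ => rfl
      map_smul' := fun c v => (algebraMap_smul K c (v : W)).symm }
  have hf : Function.Injective f := Subtype.val_injective
  -- Weight one means that `K`-proportional vectors of `U` are already `F`-proportional, so points
  -- of `L_U` can be counted in the projective space of `U` over `F`.
  have hinj : Function.Injective (Projectivization.map f hf) := by
    intro P Q
    induction P using Projectivization.ind with | h v hv =>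
    induction Q using Projectivization.ind with | h w hw =>
    intro e
    rw [Projectivization.map_mk, Projectivization.map_mk] at e
    have hv0 : (v : W) ≠ 0 := fun e => hv (Subtype.ext e)
    have hw0 : (w : W) ≠ 0 := fun e => hw (Subtype.ext e)
    obtain ⟨a, ha⟩ := (Projectivization.mk_eq_mk_iff' K _ _ hv0 hw0).1 e
    have h1 := h (Projectivization.mk K (w : W) hw0) ⟨w, hw0, w.2, rfl⟩
    let w' : ↥(U ⊓ (Projectivization.mk K (w : W) hw0).submodule.restrictScalars F) :=
      ⟨w, (mem_inf_submodule_mk hw0).2 ⟨w.2, 1, one_smul K _⟩⟩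
    let v' : ↥(U ⊓ (Projectivization.mk K (w : W) hw0).submodule.restrictScalars F) :=
      ⟨v, (mem_inf_submodule_mk hw0).2 ⟨v.2, a, ha⟩⟩
    obtain ⟨c, hc⟩ := exists_smul_eq_of_finrank_eq_one h1
      (x := w') (fun e => hw0 (congrArg Subtype.val e)) v'
    have hc' : c • (w : W) = v := congrArg Subtype.val hc
    exact (Projectivization.mk_eq_mk_iff' F v w hv hw).2 ⟨c, Subtype.ext hc'⟩
  have hrange : linearSet F K U = Set.range (Projectivization.map f hf) := by
    ext P
    constructor
    · rintro ⟨v, hv, hvU, rfl⟩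
      exact ⟨Projectivization.mk F ⟨v, hvU⟩ (fun e => hv (congrArg Subtype.val e)),
        Projectivization.map_mk ..⟩
    · rintro ⟨Q, rfl⟩
      induction Q using Projectivization.ind with | h v hv =>
      exact ⟨v, fun e => hv (Subtype.ext e), v.2, Projectivization.map_mk ..⟩
  rw [IsScattered, hrange, ← Nat.card_coe_set_eq, Nat.card_range_of_injective hinj,
    Projectivization.card'', Module.natCard_eq_pow_finrank (K := F)]

end Weight

/-! ### Points by slope, Frobenius, and the weight-two slopes -/

section Slope

/-- The point `⟨(1, m)⟩_K` of the projective line over `K`. -/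
def pointOfSlope {K : Type*} [Field K] (m : K) : ℙ K (K × K) :=
  Projectivization.mk K ((1 : K), m) (by simp)

theorem pointOfSlope_injective {K : Type*} [Field K] :
    Function.Injective (pointOfSlope : K → ℙ K (K × K)) := by
  intro m n h
  obtain ⟨a, ha⟩ := (Projectivization.mk_eq_mk_iff' K _ _ _ _).1 h
  simp only [Prod.smul_mk, Prod.mk.injEq, smul_eq_mul, mul_one] at ha
  rw [← ha.2, ha.1, one_mul]

theorem pointOneZero_eq (K : Type*) [Field K] : pointOneZero K = pointOfSlope 0 := rfl

variable {F K : Type*} [Field F] [Finite F] [Field K] [Algebra F K]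

variable (F K) in
/-- The automorphism `x ↦ x ^ |F|`, as an `F`-algebra endomorphism. -/
noncomputable def frob : K →ₐ[F] K :=
  letI := Fintype.ofFinite F
  FiniteField.frobeniusAlgHom F K

theorem frob_apply (x : K) : frob F K x = x ^ Nat.card F := by
  let := Fintype.ofFinite F
  rw [Nat.card_eq_fintype_card]
  rfl

theorem frob_frob_apply (x : K) : frob F K (frob F K x) = x ^ Nat.card F ^ 2 := by
  rw [frob_apply, frob_apply, ← pow_mul, sq]

theorem frob_frob_frob_apply (x : K) :
    frob F K (frob F K (frob F K x)) = x ^ Nat.card F ^ 3 := by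
  rw [frob_apply, frob_frob_apply, ← pow_mul, ← pow_succ]

theorem exists_algebraMap_eq_of_frob_eq [FiniteDimensional F K] {x : K} (h : frob F K x = x) :
    ∃ c : F, algebraMap F K c = x := by
  let := Fintype.ofFinite F
  have := Module.finite_of_finite F (M := K)
  have hx : x ∈ (⊥ : IntermediateField F K) := by
    refine (IsGalois.mem_bot_iff_fixed x).2 fun g => ?_
    obtain ⟨n, rfl⟩ := (FiniteField.bijective_frobeniusAlgEquivOfAlgebraic_pow F K).2 g
    change (FiniteField.frobeniusAlgEquivOfAlgebraic F K ^ (n : ℕ)) x = x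
    rw [AlgEquiv.coe_pow]
    exact Function.iterate_fixed h _
  exact IntermediateField.mem_bot.1 hx

theorem frob_frob_frob_frob_apply (hK : Module.finrank F K = 4) (x : K) :
    frob F K (frob F K (frob F K (frob F K x))) = x := by
  have : FiniteDimensional F K := FiniteDimensional.of_finrank_pos (by omega)
  have := Module.finite_of_finite F (M := K)
  have := Fintype.ofFinite K
  rw [frob_apply, frob_frob_frob_apply, ← pow_mul, ← pow_succ, show 3 + 1 = 4 from rfl, ← hK,
    ← Module.natCard_eq_pow_finrank, Nat.card_eq_fintype_card, FiniteField.pow_card]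

theorem algebraMap_norm_of_finrank_eq_four (hK : Module.finrank F K = 4) (b : K) :
    algebraMap F K (Algebra.norm F b) =
      b * frob F K b * frob F K (frob F K b) * frob F K (frob F K (frob F K b)) := by
  have : FiniteDimensional F K := FiniteDimensional.of_finrank_pos (by omega)
  have := Module.finite_of_finite F (M := K)
  rw [FiniteField.algebraMap_norm_eq_prod_pow, hK, frob_frob_frob_apply, frob_frob_apply,
    frob_apply]
  simp [Finset.prod_range_succ]

theorem algebraMap_norm_of_finrank_eq_two {E : Type*} [Field E] [Algebra F E] [Algebra E K]
    [IsScalarTower F E K] (hE : Module.finrank F E = 2) (hK : Module.finrank F K = 4) (b : K) :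
    algebraMap E K (Algebra.norm E b) = b * frob F K (frob F K b) := by
  have : FiniteDimensional F K := FiniteDimensional.of_finrank_pos (by omega)
  have : FiniteDimensional F E := FiniteDimensional.of_finrank_pos (by omega)
  have := Module.finite_of_finite F (M := K)
  have h2 : Module.finrank E K = 2 := by
    have := Module.finrank_mul_finrank F E K
    rw [hE, hK] at this
    omega
  rw [FiniteField.algebraMap_norm_eq_prod_pow, h2, Module.natCard_eq_pow_finrank (K := F), hE,
    frob_frob_apply]
  simp [Finset.prod_range_succ]

theorem mem_U_iff {b : K} {v : K × K} :
    v ∈ U F b ↔ v.2 = b * frob F K v.1 + frob F K (frob F K (frob F K v.1)) := by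
  rw [frob_frob_frob_apply, frob_apply]
  constructor
  · rintro ⟨x, rfl⟩
    rfl
  · intro h
    exact ⟨v.1, Prod.ext rfl h⟩

theorem weight_pointOfSlope (b m : K) :
    weight F (U F b) (pointOfSlope m) = Module.finrank F (slopeSpace (frob F K) b m) := by
  let g : K →ₗ[F] K × K := LinearMap.id.prod (LinearMap.mulLeft F m)
  have hg : Function.Injective g := fun x y h => congrArg Prod.fst h
  have hmap : U F b ⊓ (pointOfSlope m).submodule.restrictScalars F =
      (slopeSpace (frob F K) b m).map g := by
    ext v
    rw [pointOfSlope, mem_inf_submodule_mk, Submodule.mem_map]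
    constructor
    · rintro ⟨hv, a, rfl⟩
      rw [mem_U_iff] at hv
      refine ⟨a, ?_, ?_⟩
      · rw [mem_slopeSpace]
        simpa [mul_comm] using hv.symm
      · simp [g, mul_comm]
    · rintro ⟨x, hx, rfl⟩
      rw [mem_slopeSpace] at hx
      exact ⟨mem_U_iff.2 hx.symm, x, by simp [g, mul_comm]⟩
  rw [weight, hmap]
  exact (Submodule.equivMapOfInjective g hg _).finrank_eq.symm

theorem exists_pointOfSlope_eq {b : K} {P : ℙ K (K × K)} (hP : P ∈ linearSet F K (U F b)) :
    ∃ m, pointOfSlope m = P := by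
  obtain ⟨⟨x, y⟩, hv, hvU, rfl⟩ := hP
  have hx : x ≠ 0 := by
    rintro rfl
    rw [mem_U_iff] at hvU
    exact hv (Prod.ext rfl (by simpa using hvU))
  refine ⟨y / x, (Projectivization.mk_eq_mk_iff' K _ _ _ _).2 ⟨x⁻¹, ?_⟩⟩
  simp [hx, div_eq_inv_mul]

theorem mem_linearSet_of_weight_pos {b : K} {m : K}
    (h : 0 < weight F (U F b) (pointOfSlope m)) : pointOfSlope m ∈ linearSet F K (U F b) := by
  rw [weight_pointOfSlope] at h
  obtain ⟨x, hx, hx0⟩ := (slopeSpace (frob F K) b m).exists_mem_ne_zero_of_ne_bot (by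
    intro h0
    rw [h0, finrank_bot] at h
    exact h.false)
  refine ⟨(x, m * x), fun e => hx0 (congrArg Prod.fst e), mem_U_iff.2 hx.symm,
    (Projectivization.mk_eq_mk_iff' K _ _ _ _).2 ⟨x⁻¹, ?_⟩⟩
  simp [hx0, mul_comm m]

theorem weight_pos_of_mem_linearSet [FiniteDimensional F K] {b : K} {P : ℙ K (K × K)}
    (hP : P ∈ linearSet F K (U F b)) : 0 < weight F (U F b) P := by
  obtain ⟨v, hv, hvU, rfl⟩ := hP
  rw [weight, Module.finrank_pos_iff_exists_ne_zero]
  exact ⟨⟨v, (mem_inf_submodule_mk hv).2 ⟨hvU, 1, one_smul K v⟩⟩,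
    fun e => hv (congrArg Subtype.val e)⟩

theorem weight_le_two (hK : Module.finrank F K = 4) {b : K} {P : ℙ K (K × K)}
    (hP : P ∈ linearSet F K (U F b)) : weight F (U F b) P ≤ 2 := by
  have : FiniteDimensional F K := FiniteDimensional.of_finrank_pos (by omega)
  obtain ⟨m, rfl⟩ := exists_pointOfSlope_eq hP
  rw [weight_pointOfSlope]
  exact finrank_slopeSpace_le_two (fun x => exists_algebraMap_eq_of_frob_eq)
    (frob_frob_frob_frob_apply hK) b m

theorem weight_eq_one_of_ne_two (hK : Module.finrank F K = 4) {b : K} {P : ℙ K (K × K)}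
    (hP : P ∈ linearSet F K (U F b)) (h : weight F (U F b) P ≠ 2) : weight F (U F b) P = 1 := by
  have : FiniteDimensional F K := FiniteDimensional.of_finrank_pos (by omega)
  have := weight_le_two hK hP
  have := weight_pos_of_mem_linearSet hP
  omega

theorem norm_eq_one_of_weight_eq_two (hK : Module.finrank F K = 4) {b m : K}
    (h : weight F (U F b) (pointOfSlope m) = 2) : Algebra.norm F b = 1 := by
  have : FiniteDimensional F K := FiniteDimensional.of_finrank_pos (by omega)
  rw [weight_pointOfSlope] at h
  apply (algebraMap F K).injective
  rw [map_one, algebraMap_norm_of_finrank_eq_four hK]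
  exact (eq_of_finrank_slopeSpace_eq_two (fun x => exists_algebraMap_eq_of_frob_eq)
    (frob_frob_frob_frob_apply hK) h).1

theorem weight_pointOfSlope_eq_two_iff (hK : Module.finrank F K = 4) {b m : K}
    (hb : Algebra.norm F b = 1) :
    weight F (U F b) (pointOfSlope m) = 2 ↔
      frob F K m = -(b * frob F K b * frob F K (frob F K (frob F K m))) ∧
        frob F K b * (m * frob F K (frob F K (frob F K m)) - frob F K (frob F K (frob F K b)))
          = -1 := by
  have : FiniteDimensional F K := FiniteDimensional.of_finrank_pos (by omega)
  rw [weight_pointOfSlope]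
  have hN := algebraMap_norm_of_finrank_eq_four hK b
  rw [hb, map_one] at hN
  exact ⟨fun h => (eq_of_finrank_slopeSpace_eq_two (fun x => exists_algebraMap_eq_of_frob_eq)
      (frob_frob_frob_frob_apply hK) h).2,
    fun h => finrank_slopeSpace_eq_two hK (fun x => exists_algebraMap_eq_of_frob_eq)
      (frob_frob_frob_frob_apply hK) hN.symm h.1 h.2⟩

theorem weight_pointOfSlope_eq_two_iff_eq_zero (hK : Module.finrank F K = 4) {b m : K}
    (hb : b * frob F K (frob F K b) = 1) :
    weight F (U F b) (pointOfSlope m) = 2 ↔ m = 0 := by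
  have hb' : frob F K b * frob F K (frob F K (frob F K b)) = 1 := by
    rw [← map_mul, hb, map_one]
  have hN : Algebra.norm F b = 1 := by
    apply (algebraMap F K).injective
    rw [map_one, algebraMap_norm_of_finrank_eq_four hK]
    linear_combination frob F K b * frob F K (frob F K (frob F K b)) * hb + hb'
  rw [weight_pointOfSlope_eq_two_iff hK hN]
  constructor
  · rintro ⟨-, hB⟩
    have h0 : frob F K b * (m * frob F K (frob F K (frob F K m))) = 0 := by
      linear_combination hB + hb'
    have hb0 : frob F K b ≠ 0 := left_ne_zero_of_mul_eq_one hb'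
    simpa [hb0] using h0
  · rintro rfl
    simp [hb']

theorem ncard_slopes_eq (hK : Module.finrank F K = 4) {b : K}
    (hb : b * frob F K (frob F K b) ≠ 1) (hN : Algebra.norm F b = 1) :
    {m : K | weight F (U F b) (pointOfSlope m) = 2}.ncard = Nat.card F + 1 := by
  have : FiniteDimensional F K := FiniteDimensional.of_finrank_pos (by omega)
  have := Module.finite_of_finite F (M := K)
  have hσ := frob_frob_frob_frob_apply hK
  have hN' := algebraMap_norm_of_finrank_eq_four hK b
  rw [hN, map_one] at hN'
  obtain ⟨c, hc⟩ : ∃ c, c = b * (1 - frob F K b * frob F K (frob F K (frob F K b))) := ⟨_, rfl⟩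
  have hc0 : c ≠ 0 := by
    rw [hc]
    refine mul_ne_zero ?_ fun h => hb ?_
    · rintro rfl
      simp at hN'
    · linear_combination b * frob F K (frob F K b) * h - hN'
  have hset : {m : K | weight F (U F b) (pointOfSlope m) = 2} =
      {m : K | m ^ (Nat.card F + 1) = c} := by
    ext m
    rw [Set.mem_ofPred_eq, Set.mem_ofPred_eq, weight_pointOfSlope_eq_two_iff hK hN,
      slope_conditions_iff hσ hN'.symm hb, ← hc, frob_apply, pow_succ']
  have hq : 1 < Nat.card F := Finite.one_lt_card
  rw [hset]
  -- From `q⁴ - 1 = (q + 1)(q² + 1)(q - 1)`.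
  refine ncard_pow_eq_of_pow_eq_one_of_field (k := (Nat.card F ^ 2 + 1) * (Nat.card F - 1))
    ?_ hc0 ?_
  · rw [Module.natCard_eq_pow_finrank (K := F), hK]
    obtain ⟨r, hr⟩ := Nat.exists_eq_add_of_lt hq
    rw [hr, Nat.add_sub_cancel]
    ring
  · rw [pow_mul]
    have h1 : c ^ (Nat.card F ^ 2 + 1) = c * frob F K (frob F K c) := by
      rw [frob_frob_apply, pow_succ']
    have h2 := map_norm_slope hσ hN'.symm hc
    have h0 : c * frob F K (frob F K c) ≠ 0 := by
      rw [← h1]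
      exact pow_ne_zero _ hc0
    rw [h1]
    -- For nonzero `y = c σ²(c)`, `y^(q-1) = 1` amounts to `σ(y) = y`.
    apply mul_right_cancel₀ h0
    rw [← pow_succ, Nat.sub_add_cancel hq.le, one_mul, ← frob_apply, h2]

end Slope

end LinearSets

theorem theorem2p1 {F E K : Type*} [Field F] [Finite F] [Field E] [Field K]
    [Algebra F E] [Algebra E K] [Algebra F K] [IsScalarTower F E K]
    (hE : Module.finrank F E = 2) (hK : Module.finrank F K = 4) (b : K) :
    (Algebra.norm F b ≠ 1 → LinearSets.IsScattered F K (LinearSets.U F b)) ∧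
    (Algebra.norm E b = 1 →
      LinearSets.pointOneZero K ∈ LinearSets.linearSet F K (LinearSets.U F b) ∧
      LinearSets.weight F (LinearSets.U F b) (LinearSets.pointOneZero K) = 2 ∧
      ∀ P ∈ LinearSets.linearSet F K (LinearSets.U F b), P ≠ LinearSets.pointOneZero K →
        LinearSets.weight F (LinearSets.U F b) P = 1) ∧
    (Algebra.norm E b ≠ 1 → Algebra.norm F b = 1 →
      {P ∈ LinearSets.linearSet F K (LinearSets.U F b) |
        LinearSets.weight F (LinearSets.U F b) P = 2}.ncard = Nat.card F + 1 ∧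
      ∀ P ∈ LinearSets.linearSet F K (LinearSets.U F b),
        LinearSets.weight F (LinearSets.U F b) P ≠ 2 →
          LinearSets.weight F (LinearSets.U F b) P = 1) := by
  have hEK := LinearSets.algebraMap_norm_of_finrank_eq_two hE hK b
  refine ⟨fun hN => ?_, fun hN => ?_, fun hNE hN => ⟨?_, fun P hP hP2 => ?_⟩⟩
  · have : FiniteDimensional F K := FiniteDimensional.of_finrank_pos (by omega)
    refine LinearSets.isScattered_of_forall_weight_eq_one fun P hP => ?_
    refine LinearSets.weight_eq_one_of_ne_two hK hP fun h => hN ?_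
    obtain ⟨m, rfl⟩ := LinearSets.exists_pointOfSlope_eq hP
    exact LinearSets.norm_eq_one_of_weight_eq_two hK h
  · rw [hN, map_one] at hEK
    have hw := fun m => LinearSets.weight_pointOfSlope_eq_two_iff_eq_zero hK (m := m) hEK.symm
    rw [LinearSets.pointOneZero_eq]
    refine ⟨LinearSets.mem_linearSet_of_weight_pos ?_, (hw 0).2 rfl, fun P hP hP0 => ?_⟩
    · rw [(hw 0).2 rfl]
      exact two_pos
    · refine LinearSets.weight_eq_one_of_ne_two hK hP fun h => hP0 ?_
      obtain ⟨m, rfl⟩ := LinearSets.exists_pointOfSlope_eq hP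
      rw [(hw m).1 h]
  · have hb : b * LinearSets.frob F K (LinearSets.frob F K b) ≠ 1 := by
      rw [← hEK]
      intro h
      exact hNE ((algebraMap E K).injective (h.trans (map_one _).symm))
    refine Eq.trans ?_ (LinearSets.ncard_slopes_eq hK hb hN)
    rw [← Set.ncard_image_of_injective _ (LinearSets.pointOfSlope_injective (K := K))]
    congr 1
    ext P
    constructor
    · rintro ⟨hP, h⟩
      obtain ⟨m, rfl⟩ := LinearSets.exists_pointOfSlope_eq hP
      exact ⟨m, h, rfl⟩
    · rintro ⟨m, h, rfl⟩
      have h' : LinearSets.weight F (LinearSets.U F b) (LinearSets.pointOfSlope m) = 2 := h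
      exact ⟨LinearSets.mem_linearSet_of_weight_pos (by omega), h'⟩
  · exact LinearSets.weight_eq_one_of_ne_two hK hP hP2
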